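/- **Proposition (Worst-case effective depth with high noise).** Let $\mathcal N$ be a single-qubit quantum channel (a completely positive trace-preserving linear map) with normal form parameters $\mathbf t,\mathbf D\in\mathbb R^3$; that is, $\mathcal N(\cdot)=W\mathcal N'(R^\dagger(\cdot)R)W^\dagger$ for some single-qubit unitaries $W,R$ and some channel $\mathcal N'$ with $$\mathcal N'\Big(\tfrac{I+\mathbf w\cdot\boldsymbol\sigma}{2}\Big)=\tfrac12\big(I+(\mathbf t+D\mathbf w)\cdot\boldsymbol\sigma\big),\qquad D=\mathrm{diag}(D_X,D_Y,D_Z),\quad \boldsymbol\sigma=(X,Y,Z).$$ Assume $D_P\neq 1$ for all $P\in\{X,Y,Z\}$ and put $$b:=12\max_{P\in\{X,Y,Z\}}\frac{|D_P|}{1-D_P}.$$ Let $n,L\ge 0$ and let $$\Phi=\mathcal V\circ\mathcal N^{\otimes n}\circ\mathcal U_L\circ\cdots\circ\mathcal N^{\otimes n}\circ\mathcal U_1$$ be any (fixed) $n$-qubit noisy circuit of depth $L$, where each $\mathcal U_i=U_i(\cdot)U_i^\dagger$ is a layer of two-qubit unitary gates acting on pairwise disjoint, otherwise arbitrary, pairs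 of qubits (qubits outside these pairs are left alone), and $\mathcal V=V(\cdot)V^\dagger$ with $V$ a tensor product of single-qubit unitaries. For a traceless self-adjoint operator $X$ on $n$ qubits let $$\|X\|_{W_1}=\tfrac12\min\Big\{\sum_{i=1}^n\|X^{(i)}\|_1:\ X=\sum_{i=1}^nX^{(i)},\ X^{(i)}\text{ self-adjoint and traceless},\ \mathrm{Tr}_iX^{(i)}=0\Big\},$$ where $\|\cdot\|_1$ is the trace norm and $\mathrm{Tr}_i$ the partial trace over qubit $i$. Then for all $n$-qubit states $\rho,\sigma$ $$\|\Phi(\rho)-\Phi(\sigma)\|_{W_1}\le b^L\,\|\rho-\sigma\|_{W_1},\qquad \|\Phi(\rho)-\Phi(\sigma)\|_1\le n\,b^L\,\|\rho-\sigma\|_1 .$$ Moreover, there are absolute constants $C,K>0$ such that, for every $\varepsilon>0$ and every $n$ with $n\ge K$ or $n/\varepsilon\ge K$, if $0<b<1$ and $$L\ \ge\ \frac{C\,\log(n/\varepsilon)}{\log(b^{-1})},$$ then $\|\Phi(\rho)-\Phi(\sigma)\|_1\le\varepsilon$ for all such circuits $\Phi$ and all $n$-qubit states $\rho,\sigma$.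 -/

import Mathlib

open scoped Matrix BigOperators ComplexOrder

namespace NoisyQC

/-- Linear operators on one qubit, `ℂ²`. -/
abbrev Op1 : Type := Matrix (Fin 2) (Fin 2) ℂ

/-- Linear operators on `n` qubits, `(ℂ²)^{⊗n}`, in the computational basis indexed by bit strings. -/
abbrev Op (n : ℕ) : Type := Matrix (Fin n → Fin 2) (Fin n → Fin 2) ℂ

/-- The trace norm `‖A‖₁ = Tr √(A†A)`: the sum of the singular values of `A`. -/
noncomputable def traceNorm {ι : Type} [Fintype ι] [DecidableEq ι] (A : Matrix ι ι ℂ) : ℝ :=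
  ∑ i, Real.sqrt ((Matrix.isHermitian_conjTranspose_mul_self A).eigenvalues i)

/-- Density operators: positive semidefinite of trace one. -/
def IsState {n : ℕ} (ρ : Op n) : Prop :=
  ρ.PosSemidef ∧ ρ.trace = 1

/-- The partial trace `Tr_i` over the `i`-th qubit. -/
noncomputable def partialTrace {n : ℕ} (i : Fin n) (X : Op n) :
    Matrix ({j : Fin n // j ≠ i} → Fin 2) ({j : Fin n // j ≠ i} → Fin 2) ℂ :=
  fun x y => ∑ s : Fin 2,
    X ((Equiv.funSplitAt i (Fin 2)).symm (s, x)) ((Equiv.funSplitAt i (Fin 2)).symm (s, y))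

/-- The quantum `W₁` norm of a traceless self-adjoint operator `X`: half the minimum of
`∑ i, ‖X⁽ⁱ⁾‖₁` over the decompositions `X = ∑ i, X⁽ⁱ⁾` into traceless self-adjoint operators
with `Tr_i X⁽ⁱ⁾ = 0`. -/
noncomputable def w1Norm {n : ℕ} (X : Op n) : ℝ :=
  (1 / 2) * sInf {r : ℝ | ∃ Y : Fin n → Op n,
    (∀ i, (Y i).IsHermitian ∧ (Y i).trace = 0 ∧ partialTrace i (Y i) = 0) ∧
    X = ∑ i, Y i ∧ r = ∑ i, traceNorm (Y i)}

/-- The map `N ⊗ id` on operators of a qubit together with an ancilla with basis `κ`. -/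
def ampliation (N : Op1 →ₗ[ℂ] Op1) (κ : Type) (A : Matrix (Fin 2 × κ) (Fin 2 × κ) ℂ) :
    Matrix (Fin 2 × κ) (Fin 2 × κ) ℂ :=
  fun p q => N (fun a b => A (a, p.2) (b, q.2)) p.1 q.1

/-- Single-qubit quantum channels: completely positive, trace-preserving linear maps. -/
def IsChannel (N : Op1 →ₗ[ℂ] Op1) : Prop :=
  (∀ A : Op1, (N A).trace = A.trace) ∧
  ∀ (κ : Type) [Fintype κ] [DecidableEq κ] (A : Matrix (Fin 2 × κ) (Fin 2 × κ) ℂ),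
    A.PosSemidef → (ampliation N κ A).PosSemidef

/-- The Pauli matrices `X, Y, Z`, in this order. -/
noncomputable def pauli : Fin 3 → Op1 :=
  ![!![0, 1; 1, 0], !![0, -Complex.I; Complex.I, 0], !![1, 0; 0, -1]]

/-- `N'` maps `(I + w·σ)/2` to `(I + (t + D w)·σ)/2`, with `D = diag(D_X, D_Y, D_Z)`
(by linearity it is enough to prescribe the images of `I, X, Y, Z`). -/
def ActsInNormalForm (N' : Op1 →ₗ[ℂ] Op1) (t D : Fin 3 → ℝ) : Prop :=
  N' 1 = 1 + ∑ P, (t P : ℂ) • pauli P ∧ ∀ P, N' (pauli P) = (D P : ℂ) • pauli P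

/-- `t` and `D` are parameters of a normal form of the channel `N`:
`N = U N'(V† · V) U†` with `U, V` unitary and `N'` a channel in normal form. -/
def HasNormalForm (N : Op1 →ₗ[ℂ] Op1) (t D : Fin 3 → ℝ) : Prop :=
  ∃ U ∈ Matrix.unitaryGroup (Fin 2) ℂ, ∃ V ∈ Matrix.unitaryGroup (Fin 2) ℂ,
    ∃ N' : Op1 →ₗ[ℂ] Op1, IsChannel N' ∧ ActsInNormalForm N' t D ∧
      ∀ A, N A = U * N' (Vᴴ * A * V) * Uᴴ

/-- The tensor product `⊗ₖ u k` of single-qubit operators. -/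
def tensorOp {n : ℕ} (u : Fin n → Op1) : Op n :=
  fun x y => ∏ k, u k (x k) (y k)

/-- The tensor power `N^{⊗n}`: the linear map with
`|x'⟩⟨y'| ↦ ⊗ₖ N(|x'ₖ⟩⟨y'ₖ|)` for all bit strings `x', y'`. -/
noncomputable def tensorPow (N : Op1 →ₗ[ℂ] Op1) {n : ℕ} (A : Op n) : Op n :=
  ∑ x', ∑ y', A x' y' • tensorOp (fun k => N (Matrix.single (x' k) (y' k) 1))

/-- A two-qubit unitary gate acting on the ordered pair of distinct qubits `(fst, snd)`. -/
structure TwoQubitGate (n : ℕ) where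
  fst : Fin n
  snd : Fin n
  ne : fst ≠ snd
  mat : Matrix (Fin 2 × Fin 2) (Fin 2 × Fin 2) ℂ
  unitary : mat ∈ Matrix.unitaryGroup (Fin 2 × Fin 2) ℂ

/-- The set of qubits on which a gate acts. -/
def TwoQubitGate.support {n : ℕ} (g : TwoQubitGate n) : Finset (Fin n) := {g.fst, g.snd}

/-- The `n`-qubit operator of a gate: `mat` on the two qubits, the identity on the others. -/
def TwoQubitGate.op {n : ℕ} (g : TwoQubitGate n) : Op n :=
  fun x y => if ∀ k, k ∉ g.support → x k = y k
    then g.mat (x g.fst, x g.snd) (y g.fst, y g.snd) else 0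

/-- `U` is a layer of two-qubit gates acting in parallel, that is, on disjoint pairs of qubits
(the pairs are arbitrary, and qubits outside all of them are left alone). -/
def IsTwoQubitLayer {n : ℕ} (U : Op n) : Prop :=
  ∃ gs : List (TwoQubitGate n),
    gs.Pairwise (fun g h => Disjoint g.support h.support) ∧
    U = (gs.map TwoQubitGate.op).prod

/-- `V` is a layer of single-qubit unitary gates. -/
def IsSingleQubitLayer {n : ℕ} (V : Op n) : Prop :=
  ∃ u : Fin n → Op1, (∀ i, u i ∈ Matrix.unitaryGroup (Fin 2) ℂ) ∧ V = tensorOp u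

/-- The map `N^{⊗n} ∘ 𝒰_L ∘ ⋯ ∘ N^{⊗n} ∘ 𝒰_1`, where `𝒰_i(A) = U_i A U_i†`. -/
noncomputable def noisyLayers (N : Op1 →ₗ[ℂ] Op1) {n : ℕ} :
    (L : ℕ) → (Fin L → Op n) → Op n → Op n
  | 0, _, A => A
  | L + 1, U, A =>
      tensorPow N
        (U (Fin.last L) * noisyLayers N L (fun i => U i.castSucc) A * (U (Fin.last L))ᴴ)

/-- The noisy circuit `Φ = 𝒱 ∘ N^{⊗n} ∘ 𝒰_L ∘ ⋯ ∘ N^{⊗n} ∘ 𝒰_1` with `𝒱(A) = V A V†`. -/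
noncomputable def noisyCircuit (N : Op1 →ₗ[ℂ] Op1) {n L : ℕ} (U : Fin L → Op n) (V : Op n)
    (A : Op n) : Op n :=
  V * noisyLayers N L U A * Vᴴ

/-- `b = 12 max_P |D_P| / (1 - D_P)`. -/
noncomputable def noiseFactor (D : Fin 3 → ℝ) : ℝ :=
  12 * Finset.univ.sup' Finset.univ_nonempty (fun P => |D P| / (1 - D P))

end NoisyQC

open NoisyQC

namespace NoisyQC

/-! ### Trace norm of Hermitian matrices and positive trace-preserving maps. -/

section TraceNorm

variable {ι : Type} [Fintype ι] [DecidableEq ι]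

/-! Follow a decomposition `X = ∑ i, Y i`, with `Y i` Hermitian and of vanishing partial trace over
qubit `i`, through the circuit, and bound its cost `∑ i, ‖Y i‖₁`.

A unitary layer multiplies the cost by at most 3 (`HasW1Decomp.layer`). If a gate couples `i` to
`j`, the image `Z` of `Y i` vanishes once both qubits are traced out. With `E i` the complete
depolarization of qubit `i`, the splitting `Z = (Z - E i Z) + E i Z` gives a term of type `i`, of
norm at most `2‖Z‖₁`, and a term of type `j`, of norm at most `‖Z‖₁`.

A noise layer multiplies the cost by at most `∑ P, |D P|` (`traceNorm_noise_le`): where qubit `i` is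
traceless the shift `t` is invisible, and the noise there is a real combination of unitary
conjugations; on the other qubits it is a channel and contracts. Complete positivity gives `∑ P, (1
- D P) ≤ 4`, so `∑ P, |D P|` is at most 4 times the maximum of `|D P| / (1 - D P)`, that is `b / 3`
(`sum_abs_le_noiseFactor`). Hence each step costs a factor `3 * (b / 3) = b`.

For the trace norm, a traceless `X` has a decomposition of cost `2n‖X‖₁`
(`HasW1Decomp.of_trace_eq_zero`), and the trace norm is at most the cost of any decomposition.
Decomposing only after the first unitary layer saves its factor 3, which turns `2n` into `n`. -/

theorem spectral_decomposition {X : Matrix ι ι ℂ} (hX : X.IsHermitian) :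
    ∃ U : Matrix ι ι ℂ, U * Uᴴ = 1 ∧ Uᴴ * U = 1 ∧
      X = U * Matrix.diagonal (fun i => (hX.eigenvalues i : ℂ)) * Uᴴ := by
  refine ⟨hX.eigenvectorUnitary, ?_, ?_, ?_⟩
  · exact Unitary.coe_mul_star_self hX.eigenvectorUnitary
  · exact Unitary.coe_star_mul_self hX.eigenvectorUnitary
  · conv_lhs => rw [hX.spectral_theorem]
    rw [Unitary.conjStarAlgAut_apply]
    rfl

theorem traceNorm_eq_sum_abs {X : Matrix ι ι ℂ} (hX : X.IsHermitian) :
    traceNorm X = ∑ i, |hX.eigenvalues i| := by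
  obtain ⟨U, h1, h2, h3⟩ := spectral_decomposition hX
  set H := Matrix.isHermitian_conjTranspose_mul_self X
  have hsq : Xᴴ * X = U * (Matrix.diagonal (fun i => ((hX.eigenvalues i ^ 2 : ℝ) : ℂ)) * Uᴴ) := by
    rw [hX.eq]
    conv_lhs => rw [h3]
    calc _ = U * Matrix.diagonal (fun i => (hX.eigenvalues i : ℂ)) * (Uᴴ * U) *
          Matrix.diagonal (fun i => (hX.eigenvalues i : ℂ)) * Uᴴ := by
          simp only [Matrix.mul_assoc]
      _ = _ := by
          rw [h2, Matrix.mul_one, Matrix.mul_assoc U, Matrix.diagonal_mul_diagonal, Matrix.mul_assoc]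
          congr 3
          funext i
          push_cast
          ring
  -- The two eigenvalue families are indexed unrelatedly, so they are compared as multisets of roots
  -- of the characteristic polynomial.
  have hroots : (Xᴴ * X).charpoly.roots =
      Multiset.map (fun i => ((hX.eigenvalues i ^ 2 : ℝ) : ℂ)) Finset.univ.val := by
    rw [hsq, Matrix.charpoly_mul_comm, Matrix.mul_assoc, h2, Matrix.mul_one,
      Matrix.charpoly_diagonal]
    have h := Polynomial.roots_multiset_prod_X_sub_C
      (Multiset.map (fun i => ((hX.eigenvalues i ^ 2 : ℝ) : ℂ)) Finset.univ.val)
    rwa [Multiset.map_map] at h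
  have hm := hroots.symm.trans H.roots_charpoly_eq_eigenvalues
  have hm2 := congrArg (fun s => (s.map (fun z : ℂ => Real.sqrt z.re)).sum) hm
  simp only [Multiset.map_map, Function.comp_def, Complex.ofReal_re] at hm2
  change ∑ i, √(H.eigenvalues i) = _
  refine Eq.trans ?_ (hm2.symm.trans ?_)
  · rfl
  · exact Finset.sum_congr rfl fun i _ => Real.sqrt_sq_eq_abs _

/-- Jordan decomposition. With `traceNorm_sub_le` it makes the trace norm the minimum of `Tr P + Tr
Q` over such splittings; the triangle inequality and contractivity below follow from this alone. -/
theorem exists_posSemidef_sub {X : Matrix ι ι ℂ} (hX : X.IsHermitian) :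
    ∃ P Q : Matrix ι ι ℂ, P.PosSemidef ∧ Q.PosSemidef ∧ X = P - Q ∧
      P.trace.re + Q.trace.re = traceNorm X := by
  obtain ⟨U, h1, h2, h3⟩ := spectral_decomposition hX
  have key : ∀ d : ι → ℝ, (U * Matrix.diagonal (fun i => (d i : ℂ)) * Uᴴ).trace.re = ∑ i, d i := by
    intro d
    rw [Matrix.trace_mul_comm, ← Matrix.mul_assoc, h2, Matrix.one_mul, Matrix.trace_diagonal]
    simp
  have pos : ∀ d : ι → ℝ, (∀ i, 0 ≤ d i) →
      (U * Matrix.diagonal (fun i => (d i : ℂ)) * Uᴴ).PosSemidef := by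
    intro d hd
    refine Matrix.PosSemidef.mul_mul_conjTranspose_same (Matrix.PosSemidef.diagonal ?_) U
    intro i
    simpa using hd i
  refine ⟨U * Matrix.diagonal (fun i => ((max (hX.eigenvalues i) 0 : ℝ) : ℂ)) * Uᴴ,
    U * Matrix.diagonal (fun i => ((max (-hX.eigenvalues i) 0 : ℝ) : ℂ)) * Uᴴ,
    pos _ fun i => le_max_right _ _, pos _ fun i => le_max_right _ _, ?_, ?_⟩
  · conv_lhs => rw [h3]
    rw [← Matrix.sub_mul, ← Matrix.mul_sub, Matrix.diagonal_sub]
    congr 3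
    funext i
    rw [← Complex.ofReal_sub, max_comm, max_comm (-_)]
    congr 1
    rcases le_total 0 (hX.eigenvalues i) with h | h
    · rw [max_eq_right h, max_eq_left (by linarith)]; ring
    · rw [max_eq_left h, max_eq_right (by linarith)]; ring
  · rw [key, key, traceNorm_eq_sum_abs hX, ← Finset.sum_add_distrib]
    refine Finset.sum_congr rfl fun i _ => ?_
    rcases le_total 0 (hX.eigenvalues i) with h | h
    · rw [max_eq_left h, max_eq_right (by linarith), abs_of_nonneg h]; ring
    · rw [max_eq_right h, max_eq_left (by linarith), abs_of_nonpos h]; ring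

/-- In an eigenbasis of `P - Q` each eigenvalue is a difference of nonnegative diagonal entries of
`P` and `Q`, so its modulus is at most their sum. -/
theorem traceNorm_sub_le {P Q : Matrix ι ι ℂ} (hP : P.PosSemidef) (hQ : Q.PosSemidef) :
    traceNorm (P - Q) ≤ P.trace.re + Q.trace.re := by
  have hX : (P - Q).IsHermitian := hP.isHermitian.sub hQ.isHermitian
  obtain ⟨U, h1, h2, h3⟩ := spectral_decomposition hX
  have hP' := hP.conjTranspose_mul_mul_same U
  have hQ' := hQ.conjTranspose_mul_mul_same U
  have hd : Uᴴ * P * U - Uᴴ * Q * U = Matrix.diagonal (fun i => (hX.eigenvalues i : ℂ)) := by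
    rw [← Matrix.sub_mul, ← Matrix.mul_sub]
    conv_lhs => rw [h3]
    calc _ = (Uᴴ * U) * Matrix.diagonal (fun i => (hX.eigenvalues i : ℂ)) * (Uᴴ * U) := by
          simp only [Matrix.mul_assoc]
      _ = _ := by rw [h2, Matrix.one_mul, Matrix.mul_one]
  have ht : ∀ A : Matrix ι ι ℂ, (Uᴴ * A * U).trace = A.trace := by
    intro A
    rw [Matrix.trace_mul_comm, ← Matrix.mul_assoc, h1, Matrix.one_mul]
  rw [traceNorm_eq_sum_abs hX, ← ht P, ← ht Q]
  simp only [Matrix.trace, Complex.re_sum, ← Finset.sum_add_distrib, Matrix.diag_apply]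
  refine Finset.sum_le_sum fun i _ => ?_
  have e := congrArg Complex.re (congrFun (congrFun hd i) i)
  simp only [Matrix.sub_apply, Complex.sub_re, Matrix.diagonal_apply_eq, Complex.ofReal_re] at e
  have p := (Complex.le_def.1 (hP'.diag_nonneg (i := i))).1
  have q := (Complex.le_def.1 (hQ'.diag_nonneg (i := i))).1
  simp only [Complex.zero_re] at p q
  rw [← e, abs_le]
  constructor <;> linarith

theorem traceNorm_nonneg (X : Matrix ι ι ℂ) : 0 ≤ traceNorm X :=
  Finset.sum_nonneg fun _ _ => Real.sqrt_nonneg _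

theorem traceNorm_add_le {X Y : Matrix ι ι ℂ} (hX : X.IsHermitian) (hY : Y.IsHermitian) :
    traceNorm (X + Y) ≤ traceNorm X + traceNorm Y := by
  obtain ⟨P, Q, hP, hQ, e, t⟩ := exists_posSemidef_sub hX
  obtain ⟨P', Q', hP', hQ', e', t'⟩ := exists_posSemidef_sub hY
  have : X + Y = (P + P') - (Q + Q') := by rw [e, e']; abel
  rw [this]
  refine (traceNorm_sub_le (hP.add hP') (hQ.add hQ')).trans (le_of_eq ?_)
  rw [Matrix.trace_add, Matrix.trace_add, Complex.add_re, Complex.add_re, ← t, ← t']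
  ring

theorem traceNorm_neg_le {X : Matrix ι ι ℂ} (hX : X.IsHermitian) :
    traceNorm (-X) ≤ traceNorm X := by
  obtain ⟨P, Q, hP, hQ, e, t⟩ := exists_posSemidef_sub hX
  rw [← t, e, neg_sub, add_comm]
  exact traceNorm_sub_le hQ hP

theorem traceNorm_zero : traceNorm (0 : Matrix ι ι ℂ) = 0 := by
  refine le_antisymm ?_ (traceNorm_nonneg _)
  simpa using traceNorm_sub_le (Matrix.PosSemidef.zero (n := ι) (R := ℂ)) Matrix.PosSemidef.zero

omit [Fintype ι] [DecidableEq ι] in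
theorem isHermitian_real_smul {X : Matrix ι ι ℂ} (hX : X.IsHermitian) (c : ℝ) :
    ((c : ℂ) • X).IsHermitian := by
  ext i j
  simp [Matrix.conjTranspose_apply, hX.apply]

theorem traceNorm_smul_le {X : Matrix ι ι ℂ} (hX : X.IsHermitian) (c : ℝ) :
    traceNorm ((c : ℂ) • X) ≤ |c| * traceNorm X := by
  have key : ∀ {Y : Matrix ι ι ℂ}, Y.IsHermitian → ∀ d : ℝ, 0 ≤ d →
      traceNorm ((d : ℂ) • Y) ≤ d * traceNorm Y := by
    intro Y hY d hd
    obtain ⟨P, Q, hP, hQ, e, t⟩ := exists_posSemidef_sub hY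
    have hd' : (0 : ℂ) ≤ d := by simpa using hd
    rw [← t, e, smul_sub]
    refine (traceNorm_sub_le (hP.smul hd') (hQ.smul hd')).trans (le_of_eq ?_)
    simp [Matrix.trace_smul]
    ring
  rcases le_total 0 c with h | h
  · rw [abs_of_nonneg h]; exact key hX c h
  · have h' : (c : ℂ) • X = ((-c : ℝ) : ℂ) • (-X) := by simp
    rw [abs_of_nonpos h, h']
    refine (key hX.neg _ (by linarith)).trans ?_
    exact mul_le_mul_of_nonneg_left (traceNorm_neg_le hX) (by linarith)

theorem traceNorm_sum_le {α : Type*} (s : Finset α) {X : α → Matrix ι ι ℂ}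
    (hX : ∀ a ∈ s, (X a).IsHermitian) :
    (∑ a ∈ s, X a).IsHermitian ∧ traceNorm (∑ a ∈ s, X a) ≤ ∑ a ∈ s, traceNorm (X a) := by
  classical
  induction s using Finset.induction_on with
  | empty => simp [traceNorm_zero]
  | insert a s ha ih =>
    rw [Finset.sum_insert ha, Finset.sum_insert ha]
    obtain ⟨h1, h2⟩ := ih fun b hb => hX b (Finset.mem_insert_of_mem hb)
    have h3 := hX a (Finset.mem_insert_self a s)
    exact ⟨h3.add h1, (traceNorm_add_le h3 h1).trans (by linarith)⟩

/-- Positive trace-preserving linear maps. -/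
def IsPTP (F : Matrix ι ι ℂ →ₗ[ℂ] Matrix ι ι ℂ) : Prop :=
  (∀ A, (F A).trace = A.trace) ∧ ∀ A, A.PosSemidef → (F A).PosSemidef

omit [DecidableEq ι] in
theorem IsPTP.id : IsPTP (LinearMap.id : Matrix ι ι ℂ →ₗ[ℂ] Matrix ι ι ℂ) :=
  ⟨fun _ => rfl, fun _ h => h⟩

omit [DecidableEq ι] in
theorem IsPTP.comp {F G : Matrix ι ι ℂ →ₗ[ℂ] Matrix ι ι ℂ} (hF : IsPTP F) (hG : IsPTP G) :
    IsPTP (F ∘ₗ G) :=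
  ⟨fun A => (hF.1 _).trans (hG.1 A), fun A h => hF.2 _ (hG.2 A h)⟩

theorem IsPTP.isHermitian {F : Matrix ι ι ℂ →ₗ[ℂ] Matrix ι ι ℂ} (hF : IsPTP F)
    {X : Matrix ι ι ℂ} (hX : X.IsHermitian) : (F X).IsHermitian := by
  obtain ⟨P, Q, hP, hQ, e, -⟩ := exists_posSemidef_sub hX
  rw [e, map_sub]
  exact (hF.2 P hP).isHermitian.sub (hF.2 Q hQ).isHermitian

theorem IsPTP.traceNorm_le {F : Matrix ι ι ℂ →ₗ[ℂ] Matrix ι ι ℂ} (hF : IsPTP F)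
    {X : Matrix ι ι ℂ} (hX : X.IsHermitian) : traceNorm (F X) ≤ traceNorm X := by
  obtain ⟨P, Q, hP, hQ, e, t⟩ := exists_posSemidef_sub hX
  rw [← t, e, map_sub, ← hF.1 P, ← hF.1 Q]
  exact traceNorm_sub_le (hF.2 P hP) (hF.2 Q hQ)

/-- Conjugation `A ↦ U A U†`. -/
noncomputable def conjMap (U : Matrix ι ι ℂ) : Matrix ι ι ℂ →ₗ[ℂ] Matrix ι ι ℂ where
  toFun A := U * A * Uᴴ
  map_add' A B := by rw [Matrix.mul_add, Matrix.add_mul]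
  map_smul' c A := by simp

theorem conjMap_apply (U A : Matrix ι ι ℂ) : conjMap U A = U * A * Uᴴ := rfl

end TraceNorm

/-! ### Tensor products of one-qubit maps, and depolarization of a single qubit. -/

section TensorMap

open Function

variable {n : ℕ}

/-- The tensor product `⊗ₖ f k` of linear maps on one-qubit operators. -/
noncomputable def tensorMap (f : Fin n → Op1 →ₗ[ℂ] Op1) : Op n →ₗ[ℂ] Op n where
  toFun A := ∑ x', ∑ y', A x' y' • tensorOp (fun k => f k (Matrix.single (x' k) (y' k) 1))
  map_add' A B := by simp only [Matrix.add_apply, add_smul, Finset.sum_add_distrib]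
  map_smul' c A := by
    simp only [Matrix.smul_apply, smul_assoc, Finset.smul_sum, RingHom.id_apply]

theorem tensorMap_apply (f : Fin n → Op1 →ₗ[ℂ] Op1) (A : Op n) (x y : Fin n → Fin 2) :
    tensorMap f A x y = ∑ x', ∑ y', A x' y' *
      ∏ k, f k (Matrix.single (x' k) (y' k) 1) (x k) (y k) := by
  change (∑ x', ∑ y', A x' y' • tensorOp (fun k => f k (Matrix.single (x' k) (y' k) 1))) x y = _
  simp only [Matrix.sum_apply, Matrix.smul_apply, smul_eq_mul]
  rfl

theorem tensorPow_eq_tensorMap (N : Op1 →ₗ[ℂ] Op1) (A : Op n) :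
    tensorPow N A = tensorMap (fun _ => N) A := rfl

theorem linearMap_apply_eq_sum (f : Op1 →ₗ[ℂ] Op1) (A : Op1) (a b : Fin 2) :
    f A a b = ∑ s, ∑ t, A s t * f (Matrix.single s t 1) a b := by
  conv_lhs => rw [Matrix.matrix_eq_sum_single A]
  simp only [map_sum, Matrix.sum_apply]
  refine Finset.sum_congr rfl fun s _ => Finset.sum_congr rfl fun t _ => ?_
  have : Matrix.single s t (A s t) = A s t • Matrix.single s t (1 : ℂ) := by simp
  rw [this, map_smul, Matrix.smul_apply, smul_eq_mul]

theorem tensorMap_tensorOp (f : Fin n → Op1 →ₗ[ℂ] Op1) (a : Fin n → Op1) :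
    tensorMap f (tensorOp a) = tensorOp (fun k => f k (a k)) := by
  ext x y
  rw [tensorMap_apply]
  simp only [tensorOp, linearMap_apply_eq_sum (f _) (a _), Fintype.prod_sum,
    ← Finset.prod_mul_distrib]

theorem tensorMap_comp (f g : Fin n → Op1 →ₗ[ℂ] Op1) (A : Op n) :
    tensorMap f (tensorMap g A) = tensorMap (fun k => f k ∘ₗ g k) A := by
  change tensorMap f (∑ x', ∑ y', A x' y' •
    tensorOp (fun k => g k (Matrix.single (x' k) (y' k) 1))) = _
  simp only [map_sum, map_smul, tensorMap_tensorOp]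
  rfl

/-- The action of a one-qubit map on the `i`-th qubit, in coordinates. -/
def localApply (g : Op1 →ₗ[ℂ] Op1) (i : Fin n) (A : Op n) : Op n :=
  fun x y => g (fun a b => A (update x i a) (update y i b)) (x i) (y i)

theorem localApply_apply (g : Op1 →ₗ[ℂ] Op1) (i : Fin n) (A : Op n) (x y : Fin n → Fin 2) :
    localApply g i A x y =
      g (Matrix.of fun a b => A (update x i a) (update y i b)) (x i) (y i) := rfl

theorem ampliation_apply (N : Op1 →ₗ[ℂ] Op1) (κ : Type)
    (A : Matrix (Fin 2 × κ) (Fin 2 × κ) ℂ) (p q : Fin 2 × κ) :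
    ampliation N κ A p q = N (Matrix.of fun a b => A (a, p.2) (b, q.2)) p.1 q.1 := rfl

theorem tensorMap_update_id (g : Op1 →ₗ[ℂ] Op1) (i : Fin n) (A : Op n) :
    tensorMap (update (fun _ => LinearMap.id) i g) A = localApply g i A := by
  ext x y
  have e : ∀ s : Fin 2, ∀ x' : {j : Fin n // j ≠ i} → Fin 2,
      (Equiv.funSplitAt i (Fin 2)).symm (s, x') i = s := by
    intro s x'; simp [Equiv.funSplitAt, Equiv.piSplitAt]
  have e' : ∀ s : Fin 2, ∀ x' : {j : Fin n // j ≠ i} → Fin 2, ∀ k : {j : Fin n // j ≠ i},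
      (Equiv.funSplitAt i (Fin 2)).symm (s, x') k = x' k := by
    intro s x' k; simp [Equiv.funSplitAt, Equiv.piSplitAt, k.2]
  have eu : ∀ s : Fin 2, ∀ x : Fin n → Fin 2,
      (Equiv.funSplitAt i (Fin 2)).symm (s, fun k : {j : Fin n // j ≠ i} => x k) = update x i s := by
    intro s x; ext k
    by_cases hk : k = i
    · subst hk; simp [Equiv.funSplitAt, Equiv.piSplitAt]
    · simp [Equiv.funSplitAt, Equiv.piSplitAt, hk]
  have hprod : ∀ s t : Fin 2, ∀ x' y' : {j : Fin n // j ≠ i} → Fin 2,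
      ∏ k, (update (fun _ => (LinearMap.id : Op1 →ₗ[ℂ] Op1)) i g k)
        (Matrix.single ((Equiv.funSplitAt i (Fin 2)).symm (s, x') k)
          ((Equiv.funSplitAt i (Fin 2)).symm (t, y') k) 1) (x k) (y k) =
      g (Matrix.single s t 1) (x i) (y i) *
        ((if x' = fun k : {j : Fin n // j ≠ i} => x k then 1 else 0) *
          (if y' = fun k : {j : Fin n // j ≠ i} => y k then 1 else 0)) := by
    intro s t x' y'
    rw [Fintype.prod_eq_mul_prod_subtype_ne _ i, update_self, e, e]
    congr 1
    have : ∀ k : {j : Fin n // j ≠ i}, (update (fun _ => (LinearMap.id : Op1 →ₗ[ℂ] Op1)) i g k)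
        (Matrix.single ((Equiv.funSplitAt i (Fin 2)).symm (s, x') k)
          ((Equiv.funSplitAt i (Fin 2)).symm (t, y') k) 1) (x k) (y k) =
        (if x' k = x k then 1 else 0) * (if y' k = y k then 1 else 0) := by
      intro k
      rw [update_of_ne k.2, e', e', LinearMap.id_apply, Matrix.single_apply]
      by_cases h1 : x' k = x k <;> by_cases h2 : y' k = y k <;> simp [h1, h2]
    simp only [this, Finset.prod_mul_distrib, Finset.prod_ite_zero, Finset.prod_const_one,
      funext_iff, Finset.mem_univ, true_implies]
  rw [tensorMap_apply, ← (Equiv.funSplitAt i (Fin 2)).symm.sum_comp, Fintype.sum_prod_type]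
  conv_lhs =>
    enter [2, s, 2, x']
    rw [← (Equiv.funSplitAt i (Fin 2)).symm.sum_comp, Fintype.sum_prod_type]
    enter [2, t, 2, y']
    rw [hprod]
  rw [localApply_apply, linearMap_apply_eq_sum]
  refine Finset.sum_congr rfl fun s _ => ?_
  rw [Finset.sum_comm]
  refine Finset.sum_congr rfl fun t _ => ?_
  simp only [mul_ite, mul_one, mul_zero, Finset.sum_ite_eq', Finset.mem_univ, if_true, eu,
    Matrix.of_apply]

theorem funSplitAt_symm_snd (i : Fin n) (x : Fin n → Fin 2) (s : Fin 2) :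
    (Equiv.funSplitAt i (Fin 2)).symm (s, (Equiv.funSplitAt i (Fin 2) x).2) = update x i s := by
  ext k
  by_cases hk : k = i
  · subst hk; simp [Equiv.funSplitAt, Equiv.piSplitAt]
  · simp [Equiv.funSplitAt, Equiv.piSplitAt, hk]

theorem funSplitAt_fst (i : Fin n) (x : Fin n → Fin 2) :
    (Equiv.funSplitAt i (Fin 2) x).1 = x i := rfl

/-- Splitting off qubit `i` and treating the rest as ancilla brings complete positivity, stated
through `ampliation`, to bear on `n` qubits. -/
theorem localApply_eq_submatrix (g : Op1 →ₗ[ℂ] Op1) (i : Fin n) (A : Op n) :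
    localApply g i A = (ampliation g ({j : Fin n // j ≠ i} → Fin 2)
      (A.submatrix (Equiv.funSplitAt i (Fin 2)).symm (Equiv.funSplitAt i (Fin 2)).symm)).submatrix
        (Equiv.funSplitAt i (Fin 2)) (Equiv.funSplitAt i (Fin 2)) := by
  ext x y
  simp only [localApply_apply, ampliation_apply, Matrix.submatrix_apply, funSplitAt_symm_snd, funSplitAt_fst]

theorem trace_submatrix_equiv {α β : Type*} [Fintype α] [Fintype β] (e : α ≃ β)
    (A : Matrix β β ℂ) : (A.submatrix e e).trace = A.trace := by
  simp only [Matrix.trace, Matrix.diag_apply, Matrix.submatrix_apply]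
  exact e.sum_comp fun b => A b b

theorem trace_ampliation {g : Op1 →ₗ[ℂ] Op1} (hg : ∀ A, (g A).trace = A.trace)
    (κ : Type) [Fintype κ] (A : Matrix (Fin 2 × κ) (Fin 2 × κ) ℂ) :
    (ampliation g κ A).trace = A.trace := by
  simp only [Matrix.trace, Matrix.diag_apply, ampliation, Fintype.sum_prod_type_right]
  exact Finset.sum_congr rfl fun k _ => hg fun a b => A (a, k) (b, k)

theorem isPTP_local {g : Op1 →ₗ[ℂ] Op1} (hg : IsChannel g) (i : Fin n) :
    IsPTP (tensorMap (update (fun _ => LinearMap.id) i g)) := by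
  constructor
  · intro A
    rw [tensorMap_update_id, localApply_eq_submatrix, trace_submatrix_equiv,
      trace_ampliation hg.1, trace_submatrix_equiv]
  · intro A hA
    rw [tensorMap_update_id, localApply_eq_submatrix]
    exact (hg.2 _ _ (hA.submatrix _)).submatrix _

theorem tensorMap_id : tensorMap (fun _ : Fin n => LinearMap.id) = LinearMap.id := by
  ext1 A
  ext x y
  rw [tensorMap_apply]
  have : ∀ x' y' : Fin n → Fin 2, ∏ k, (LinearMap.id : Op1 →ₗ[ℂ] Op1)
      (Matrix.single (x' k) (y' k) 1) (x k) (y k) =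
      (if x' = x then 1 else 0) * (if y' = y then 1 else 0) := by
    intro x' y'
    have : ∀ k, (LinearMap.id : Op1 →ₗ[ℂ] Op1) (Matrix.single (x' k) (y' k) 1) (x k) (y k) =
        (if x' k = x k then 1 else 0) * (if y' k = y k then 1 else 0) := by
      intro k
      rw [LinearMap.id_apply, Matrix.single_apply]
      by_cases h1 : x' k = x k <;> by_cases h2 : y' k = y k <;> simp [h1, h2]
    simp only [this, Finset.prod_mul_distrib, Finset.prod_ite_zero, Finset.prod_const_one,
      funext_iff, Finset.mem_univ, true_implies]
  simp only [this]
  simp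

/-- The factors are applied one qubit at a time, each step being positive and trace preserving by
`isPTP_local`. -/
theorem isPTP_tensorMap {f : Fin n → Op1 →ₗ[ℂ] Op1} (hf : ∀ k, IsChannel (f k)) :
    IsPTP (tensorMap f) := by
  have key : ∀ S : Finset (Fin n),
      IsPTP (tensorMap fun k => if k ∈ S then f k else LinearMap.id) := by
    intro S
    induction S using Finset.induction_on with
    | empty => simpa [tensorMap_id] using IsPTP.id
    | insert a S ha ih =>
      convert (isPTP_local (hf a) a).comp ih
      ext1 A
      rw [LinearMap.comp_apply, tensorMap_comp]
      congr 2
      funext k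
      by_cases hk : k = a
      · subst hk; simp [ha]
      · simp [hk]
  simpa using key Finset.univ

theorem posSemidef_ampliation_conjMap (K : Op1) (κ : Type) [Fintype κ] [DecidableEq κ]
    {A : Matrix (Fin 2 × κ) (Fin 2 × κ) ℂ} (hA : A.PosSemidef) :
    (ampliation (conjMap K) κ A).PosSemidef := by
  convert hA.mul_mul_conjTranspose_same
    (Matrix.of fun p q : Fin 2 × κ => if p.2 = q.2 then K p.1 q.1 else 0) using 1
  ext p q
  simp only [ampliation_apply, conjMap_apply, Matrix.mul_apply, Matrix.conjTranspose_apply, Matrix.of_apply,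
       Fintype.sum_prod_type_right, Finset.sum_mul, ite_mul, zero_mul, apply_ite star, star_zero,
    mul_ite, mul_zero, Finset.sum_ite_irrel, Finset.sum_const_zero, Finset.sum_ite_eq,
    Finset.mem_univ, if_true]

theorem isChannel_conjMap {K : Op1} (hK : K ∈ Matrix.unitaryGroup (Fin 2) ℂ) :
    IsChannel (conjMap K) := by
  refine ⟨fun A => ?_, fun κ _ _ A hA => posSemidef_ampliation_conjMap K κ hA⟩
  rw [conjMap_apply, Matrix.trace_mul_comm, ← Matrix.mul_assoc]
  have : Kᴴ * K = 1 := (Matrix.mem_unitaryGroup_iff').1 hK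
  rw [this, Matrix.one_mul]

/-- The completely depolarizing channel `A ↦ Tr(A) I / 2`. -/
noncomputable def depol : Op1 →ₗ[ℂ] Op1 where
  toFun A := (A.trace / 2) • 1
  map_add' A B := by rw [Matrix.trace_add, add_div, add_smul]
  map_smul' c A := by simp [mul_div_assoc, smul_smul]

theorem depol_apply (A : Op1) : depol A = (A.trace / 2) • 1 := rfl

theorem isChannel_depol : IsChannel depol := by
  refine ⟨fun A => ?_, fun κ _ _ A hA => ?_⟩
  · simp [depol_apply, Matrix.trace_smul]
  -- Kraus form of the depolarizing channel, with the four matrix units as Kraus operators up to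
  -- scale.
  · have : ampliation depol κ A = (1 / 2 : ℂ) • ∑ a : Fin 2, ∑ b : Fin 2,
        ampliation (conjMap (Matrix.single a b 1)) κ A := by
      ext ⟨p, p'⟩ ⟨q, q'⟩
      fin_cases p <;> fin_cases q <;>
      simp [ampliation_apply, depol_apply, conjMap_apply, Matrix.trace_fin_two, Matrix.mul_apply,
        Fin.sum_univ_two, Matrix.single_apply] <;> ring
    rw [this]
    have h2 : (0 : ℂ) ≤ 1 / 2 := by
      rw [Complex.le_def]; norm_num
    refine Matrix.PosSemidef.smul ?_ h2
    refine Matrix.posSemidef_sum _ fun a _ => Matrix.posSemidef_sum _ fun b _ => ?_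
    exact posSemidef_ampliation_conjMap _ κ hA

/-- Complete depolarization of the `i`-th qubit. -/
noncomputable def depolAt (i : Fin n) : Op n →ₗ[ℂ] Op n :=
  tensorMap (update (fun _ => LinearMap.id) i depol)

theorem isPTP_depolAt (i : Fin n) : IsPTP (depolAt i) := isPTP_local isChannel_depol i

theorem depolAt_apply (i : Fin n) (A : Op n) (x y : Fin n → Fin 2) :
    depolAt i A x y =
      if x i = y i then (∑ s, A (update x i s) (update y i s)) / 2 else 0 := by
  rw [depolAt, tensorMap_update_id, localApply_apply, depol_apply, Matrix.smul_apply, Matrix.one_apply]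
  simp [Matrix.trace]

theorem depolAt_eq_zero_iff (i : Fin n) (A : Op n) :
    depolAt i A = 0 ↔
      ∀ x y : Fin n → Fin 2, ∑ s, A (update x i s) (update y i s) = 0 := by
  constructor
  · intro h x y
    have := congrFun (congrFun h (update x i 0)) (update y i 0)
    rw [depolAt_apply] at this
    simpa using this
  · intro h
    ext x y
    rw [depolAt_apply, h]
    simp

/-- `depolAt i` has the same kernel as the partial trace but stays inside `Op n`, so it can be
composed and commuted with other maps; it replaces the partial trace from here on. -/
theorem partialTrace_eq_zero_iff (i : Fin n) (A : Op n) :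
    partialTrace i A = 0 ↔ depolAt i A = 0 := by
  rw [depolAt_eq_zero_iff]
  constructor
  · intro h x y
    have := congrFun (congrFun h (Equiv.funSplitAt i (Fin 2) x).2) (Equiv.funSplitAt i (Fin 2) y).2
    simpa only [partialTrace, funSplitAt_symm_snd, Matrix.zero_apply] using this
  · intro h
    ext x y
    have := h ((Equiv.funSplitAt i (Fin 2)).symm (0, x)) ((Equiv.funSplitAt i (Fin 2)).symm (0, y))
    simpa only [partialTrace, ← funSplitAt_symm_snd, Equiv.apply_symm_apply,
      Matrix.zero_apply] using this

theorem depolAt_comp_depolAt (i : Fin n) (A : Op n) : depolAt i (depolAt i A) = depolAt i A := by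
  rw [depolAt, tensorMap_comp]
  congr 2
  funext k
  by_cases hk : k = i
  · subst hk
    ext1 A
    simp [depol_apply]
  · simp [hk]

theorem depolAt_comm (i j : Fin n) (A : Op n) :
    depolAt i (depolAt j A) = depolAt j (depolAt i A) := by
  rw [depolAt, depolAt, tensorMap_comp, tensorMap_comp]
  congr 2
  funext k
  by_cases hi : k = i
  · subst hi
    by_cases hj : k = j
    · subst hj; rfl
    · simp [hj]
  · simp [hi]

/-- Depolarizing absorbs a trace-preserving map on the same qubit and commutes with maps on the
others. -/
theorem depolAt_tensorMap {f : Fin n → Op1 →ₗ[ℂ] Op1} {i : Fin n}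
    (hf : ∀ A, (f i A).trace = A.trace) (A : Op n) :
    depolAt i (tensorMap f A) = tensorMap (update f i LinearMap.id) (depolAt i A) := by
  rw [depolAt, tensorMap_comp, tensorMap_comp]
  congr 2
  funext k
  by_cases hk : k = i
  · subst hk
    ext1 A
    simp [depol_apply, hf]
  · simp [hk]

theorem depolAt_tensorMap_eq_zero {f : Fin n → Op1 →ₗ[ℂ] Op1} {i : Fin n}
    (hf : ∀ A, (f i A).trace = A.trace) {A : Op n} (hA : depolAt i A = 0) :
    depolAt i (tensorMap f A) = 0 := by
  rw [depolAt_tensorMap hf, hA, map_zero]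

theorem tensorMap_eq_update_localApply (f : Fin n → Op1 →ₗ[ℂ] Op1) (i : Fin n) (A : Op n) :
    tensorMap f A = tensorMap (update f i LinearMap.id) (localApply (f i) i A) := by
  rw [← tensorMap_update_id, tensorMap_comp]
  congr 2
  funext k
  by_cases hk : k = i
  · subst hk; simp
  · simp [hk]

theorem localApply_congr {g h : Op1 →ₗ[ℂ] Op1} (hgh : ∀ A, A.trace = 0 → g A = h A) {i : Fin n}
    {A : Op n} (hA : depolAt i A = 0) : localApply g i A = localApply h i A := by
  ext x y
  rw [localApply_apply, localApply_apply, hgh]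
  exact (depolAt_eq_zero_iff i A).1 hA x y

theorem conjMap_tensorOp (u : Fin n → Op1) (A : Op n) :
    tensorOp u * A * (tensorOp u)ᴴ = tensorMap (fun k => conjMap (u k)) A := by
  ext x y
  rw [tensorMap_apply]
  simp only [Matrix.mul_apply, Matrix.conjTranspose_apply, Finset.sum_mul]
  rw [Finset.sum_comm]
  refine Finset.sum_congr rfl fun x' _ => Finset.sum_congr rfl fun y' _ => ?_
  have : ∀ k, conjMap (u k) (Matrix.single (x' k) (y' k) 1) (x k) (y k) =
      u k (x k) (x' k) * star (u k (y k) (y' k)) := by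
    intro k
    rw [conjMap_apply, Matrix.mul_apply]
    simp [Matrix.mul_apply, Matrix.single_apply, ite_and]
  simp only [this, Finset.prod_mul_distrib, tensorOp, star_prod]
  ring

end TensorMap

/-! ### Two-qubit gates and how far a layer spreads a traced-out site. -/

section Gates

open Function

variable {n : ℕ}

/-- Replace the bits of `x` on the two qubits of a gate. -/
def TwoQubitGate.set (g : TwoQubitGate n) (x : Fin n → Fin 2) (p : Fin 2 × Fin 2) :
    Fin n → Fin 2 :=
  update (update x g.fst p.1) g.snd p.2

theorem TwoQubitGate.set_fst (g : TwoQubitGate n) (x : Fin n → Fin 2) (p : Fin 2 × Fin 2) :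
    g.set x p g.fst = p.1 := by
  rw [set, update_of_ne g.ne, update_self]

theorem TwoQubitGate.set_snd (g : TwoQubitGate n) (x : Fin n → Fin 2) (p : Fin 2 × Fin 2) :
    g.set x p g.snd = p.2 := by
  rw [set, update_self]

theorem TwoQubitGate.notMem_support {g : TwoQubitGate n} {k : Fin n} :
    k ∉ g.support ↔ k ≠ g.fst ∧ k ≠ g.snd := by
  simp [support]

theorem TwoQubitGate.set_of_notMem {g : TwoQubitGate n} (x : Fin n → Fin 2) (p : Fin 2 × Fin 2)
    {k : Fin n} (hk : k ∉ g.support) : g.set x p k = x k := by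
  rw [notMem_support] at hk
  rw [set, update_of_ne hk.2, update_of_ne hk.1]

theorem TwoQubitGate.eq_set_iff (g : TwoQubitGate n) (x z : Fin n → Fin 2) (p : Fin 2 × Fin 2) :
    z = g.set x p ↔ (∀ k, k ∉ g.support → x k = z k) ∧ p = (z g.fst, z g.snd) := by
  constructor
  · rintro rfl
    exact ⟨fun k hk => (g.set_of_notMem x p hk).symm, by rw [set_fst, set_snd]⟩
  · rintro ⟨h, rfl⟩
    funext k
    by_cases hk : k ∈ g.support
    · rcases Finset.mem_insert.1 hk with rfl | hk
      · rw [set_fst]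
      · rw [Finset.mem_singleton.1 hk, set_snd]
    · rw [g.set_of_notMem x _ hk, h k hk]

theorem TwoQubitGate.set_set (g : TwoQubitGate n) (x : Fin n → Fin 2) (p q : Fin 2 × Fin 2) :
    g.set (g.set x p) q = g.set x q :=
  (g.eq_set_iff x _ q).2 ⟨fun k hk => by
    rw [g.set_of_notMem _ _ hk, g.set_of_notMem _ _ hk], by rw [set_fst, set_snd]⟩

theorem TwoQubitGate.set_update {g : TwoQubitGate n} {i : Fin n} (hi : i ∉ g.support)
    (x : Fin n → Fin 2) (s : Fin 2) (p : Fin 2 × Fin 2) :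
    g.set (update x i s) p = update (g.set x p) i s := by
  rw [notMem_support] at hi
  rw [set, set, update_comm hi.1, update_comm hi.2]

theorem TwoQubitGate.op_apply (g : TwoQubitGate n) (x z : Fin n → Fin 2) :
    g.op x z = ∑ p, if z = g.set x p then g.mat (x g.fst, x g.snd) p else 0 := by
  simp only [eq_set_iff, ite_and, Finset.sum_ite_irrel, Finset.sum_const_zero, Finset.sum_ite_eq',
    Finset.mem_univ, if_true]
  simp only [op]

theorem TwoQubitGate.op_mul_apply (g : TwoQubitGate n) (M : Op n) (x y : Fin n → Fin 2) :
    (g.op * M) x y = ∑ p, g.mat (x g.fst, x g.snd) p * M (g.set x p) y := by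
  simp only [Matrix.mul_apply, op_apply, Finset.sum_mul]
  rw [Finset.sum_comm]
  simp only [ite_mul, zero_mul, Finset.sum_ite_eq', Finset.mem_univ, if_true]

theorem TwoQubitGate.conjMap_op_apply (g : TwoQubitGate n) (M : Op n) (x y : Fin n → Fin 2) :
    conjMap g.op M x y = ∑ p, ∑ q, g.mat (x g.fst, x g.snd) p *
      M (g.set x p) (g.set y q) * star (g.mat (y g.fst, y g.snd) q) := by
  have h : ∀ z, (M * g.opᴴ) z y = ∑ q, M z (g.set y q) * star (g.mat (y g.fst, y g.snd) q) := by
    intro z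
    have : M * g.opᴴ = (g.op * Mᴴ)ᴴ := by simp
    rw [this, Matrix.conjTranspose_apply, op_mul_apply, star_sum]
    simp [mul_comm]
  rw [conjMap_apply, Matrix.mul_assoc, op_mul_apply]
  simp only [h, Finset.mul_sum, mul_assoc]

theorem TwoQubitGate.depolAt_conjMap_op {g : TwoQubitGate n} {i : Fin n} (hi : i ∉ g.support)
    (Z : Op n) : depolAt i (conjMap g.op Z) = conjMap g.op (depolAt i Z) := by
  have hi' := notMem_support.1 hi
  ext x y
  rw [depolAt_apply, conjMap_op_apply]
  simp only [depolAt_apply, conjMap_op_apply, set_update hi, set_of_notMem _ _ hi,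
    update_of_ne hi'.1.symm, update_of_ne hi'.2.symm]
  by_cases hxy : x i = y i
  · simp only [hxy, if_true]
    rw [Finset.sum_comm, Finset.sum_div]
    refine Finset.sum_congr rfl fun p _ => ?_
    rw [Finset.sum_comm, Finset.sum_div]
    refine Finset.sum_congr rfl fun q _ => ?_
    rw [← Finset.sum_mul, ← Finset.mul_sum]
    ring
  · simp [hxy]

theorem TwoQubitGate.depolAt_depolAt_apply (g : TwoQubitGate n) (Z : Op n)
    (x y : Fin n → Fin 2) : depolAt g.fst (depolAt g.snd Z) x y =
      if x g.fst = y g.fst ∧ x g.snd = y g.snd then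
        (∑ p, Z (g.set x p) (g.set y p)) / 4 else 0 := by
  simp only [depolAt_apply, update_of_ne g.ne.symm]
  by_cases h1 : x g.fst = y g.fst <;> by_cases h2 : x g.snd = y g.snd <;>
    simp only [h1, h2, if_true, if_false, and_true, and_false, Finset.sum_const_zero, zero_div]
  rw [Fintype.sum_prod_type, ← Finset.sum_div, div_div]
  norm_num [set]

/-- Tracing over both qubits of the gate puts `g.matᴴ` next to `g.mat`, and unitarity cancels them.
-/
theorem TwoQubitGate.depolAt_depolAt_conjMap_op (g : TwoQubitGate n) (Z : Op n) :
    depolAt g.fst (depolAt g.snd (conjMap g.op Z)) = depolAt g.fst (depolAt g.snd Z) := by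
  have hu : g.matᴴ * g.mat = 1 := (Matrix.mem_unitaryGroup_iff').1 g.unitary
  ext x y
  rw [depolAt_depolAt_apply, depolAt_depolAt_apply]
  simp only [conjMap_op_apply, set_fst, set_snd, set_set, Prod.mk.eta]
  congr 2
  calc _ = ∑ p, ∑ q, Z (g.set x p) (g.set y q) * (g.matᴴ * g.mat) q p := by
        rw [Finset.sum_comm]
        refine Finset.sum_congr rfl fun p _ => ?_
        rw [Finset.sum_comm]
        refine Finset.sum_congr rfl fun q _ => ?_
        rw [Matrix.mul_apply, Finset.mul_sum]
        refine Finset.sum_congr rfl fun r _ => ?_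
        rw [Matrix.conjTranspose_apply]
        ring
    _ = _ := by
        rw [hu]
        simp [Matrix.one_apply]

theorem TwoQubitGate.isPTP_conjMap_op (g : TwoQubitGate n) : IsPTP (conjMap g.op) := by
  refine ⟨fun A => ?_, fun A hA => hA.mul_mul_conjTranspose_same _⟩
  -- Depolarization preserves the trace, so taking traces of this identity shows that the gate does
  -- too.
  have h := congrArg Matrix.trace (g.depolAt_depolAt_conjMap_op A)
  simpa only [(isPTP_depolAt _).1] using h

theorem conjMap_mul_apply (U V A : Op n) : conjMap (U * V) A = conjMap U (conjMap V A) := by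
  simp only [conjMap_apply, Matrix.conjTranspose_mul, Matrix.mul_assoc]

theorem conjMap_one_apply (A : Op n) : conjMap 1 A = A := by
  simp [conjMap_apply]

theorem isPTP_conjMap_prod (gs : List (TwoQubitGate n)) :
    IsPTP (conjMap (gs.map TwoQubitGate.op).prod) := by
  induction gs with
  | nil =>
    convert IsPTP.id (ι := Fin n → Fin 2)
    ext1 A
    simp [conjMap_one_apply]
  | cons g gs ih =>
    convert (g.isPTP_conjMap_op).comp ih
    ext1 A
    rw [List.map_cons, List.prod_cons, conjMap_mul_apply, LinearMap.comp_apply]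

theorem depolAt_conjMap_prod {gs : List (TwoQubitGate n)} {i : Fin n}
    (hi : ∀ g ∈ gs, i ∉ g.support) (Z : Op n) :
    depolAt i (conjMap (gs.map TwoQubitGate.op).prod Z) =
      conjMap (gs.map TwoQubitGate.op).prod (depolAt i Z) := by
  induction gs with
  | nil => simp [conjMap_one_apply]
  | cons g gs ih =>
    rw [List.map_cons, List.prod_cons, conjMap_mul_apply, conjMap_mul_apply,
      TwoQubitGate.depolAt_conjMap_op (hi g List.mem_cons_self),
      ih fun h hh => hi h (List.mem_cons_of_mem g hh)]

/-- A layer of two-qubit gates spreads the site `i` to at most one more site `j`. -/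
theorem exists_depolAt_depolAt_conjMap_prod {gs : List (TwoQubitGate n)}
    (hgs : gs.Pairwise fun g h => Disjoint g.support h.support) (i : Fin n) :
    -- The location of `j` is recorded for the induction: it keeps `j` off the support of a further
    -- disjoint gate that misses `i`.
    ∃ j, (j = i ∨ ∃ g ∈ gs, j ∈ g.support) ∧ ∀ X : Op n, depolAt i X = 0 →
      depolAt j (depolAt i (conjMap (gs.map TwoQubitGate.op).prod X)) = 0 := by
  induction gs with
  | nil =>
    refine ⟨i, Or.inl rfl, fun X hX => ?_⟩
    simp [conjMap_one_apply, hX]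
  | cons g gs ih =>
    obtain ⟨hg, hgs'⟩ := List.pairwise_cons.1 hgs
    by_cases hi : i ∈ g.support
    · have hf : ∀ k ∈ g.support, ∀ h ∈ gs, k ∉ h.support := fun k hk h hh hk' =>
        Finset.disjoint_left.1 (hg h hh) hk hk'
      have hfst : g.fst ∈ g.support := by simp [TwoQubitGate.support]
      have hsnd : g.snd ∈ g.support := by simp [TwoQubitGate.support]
      have key : ∀ X : Op n, depolAt i X = 0 →
          depolAt g.fst (depolAt g.snd
            (conjMap ((g :: gs).map TwoQubitGate.op).prod X)) = 0 := by
        intro X hX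
        have h0 : depolAt g.fst (depolAt g.snd X) = 0 := by
          rcases Finset.mem_insert.1 hi with rfl | hk
          · rw [depolAt_comm, hX, map_zero]
          · rw [← Finset.mem_singleton.1 hk, hX, map_zero]
        rw [List.map_cons, List.prod_cons, conjMap_mul_apply, g.depolAt_depolAt_conjMap_op,
          depolAt_conjMap_prod (hf _ hsnd), depolAt_conjMap_prod (hf _ hfst), h0, map_zero]
      rcases Finset.mem_insert.1 hi with rfl | hk
      · refine ⟨g.snd, Or.inr ⟨g, List.mem_cons_self, hsnd⟩, fun X hX => ?_⟩
        rw [depolAt_comm]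
        exact key X hX
      · obtain rfl := Finset.mem_singleton.1 hk
        exact ⟨g.fst, Or.inr ⟨g, List.mem_cons_self, hfst⟩, key⟩
    · obtain ⟨j, hj, hX⟩ := ih hgs'
      have hjg : j ∉ g.support := by
        rcases hj with rfl | ⟨h, hh, hjh⟩
        · exact hi
        · exact fun hj' => Finset.disjoint_left.1 (hg h hh) hj' hjh
      refine ⟨j, hj.imp_right ?_, fun X h0 => ?_⟩
      · rintro ⟨h, hh, hjh⟩
        exact ⟨h, List.mem_cons_of_mem g hh, hjh⟩
      · rw [List.map_cons, List.prod_cons, conjMap_mul_apply,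
          TwoQubitGate.depolAt_conjMap_op hi, TwoQubitGate.depolAt_conjMap_op hjg, hX X h0,
          map_zero]

end Gates

/-! ### Contraction by the noise on operators traceless at one qubit. -/

section Noise

open Function

theorem single_zero_zero : (Matrix.single 0 0 1 : Op1) = (1 / 2 : ℂ) • (1 + pauli 2) := by
  ext a b; fin_cases a <;> fin_cases b <;> simp [pauli]; norm_num

theorem single_one_one : (Matrix.single 1 1 1 : Op1) = (1 / 2 : ℂ) • (1 - pauli 2) := by
  ext a b; fin_cases a <;> fin_cases b <;> simp [pauli]; norm_num

theorem single_zero_one :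
    (Matrix.single 0 1 1 : Op1) = (1 / 2 : ℂ) • (pauli 0 + Complex.I • pauli 1) := by
  ext a b; fin_cases a <;> fin_cases b <;> simp [pauli]; norm_num

theorem single_one_zero :
    (Matrix.single 1 0 1 : Op1) = (1 / 2 : ℂ) • (pauli 0 - Complex.I • pauli 1) := by
  ext a b; fin_cases a <;> fin_cases b <;> simp [pauli]; norm_num

/-- Complete positivity of a normal form, tested on the Choi matrix. -/
theorem normalForm_choi {N : Op1 →ₗ[ℂ] Op1} {t D : Fin 3 → ℝ} (hN : IsChannel N)
    (hD : ActsInNormalForm N t D) :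
    0 ≤ 1 + D 0 + D 1 + D 2 ∧ 0 ≤ 1 - D 0 - D 1 + D 2 ∧
      0 ≤ 1 + D 0 - D 1 - D 2 ∧ 0 ≤ 1 - D 0 + D 1 - D 2 := by
  have hC := hN.2 (Fin 2) _ (Matrix.posSemidef_vecMulVec_self_star
    (fun p : Fin 2 × Fin 2 => if p.1 = p.2 then (1 : ℂ) else 0))
  have hb : ∀ k l : Fin 2, (Matrix.of fun a b : Fin 2 => Matrix.vecMulVec
      (fun p : Fin 2 × Fin 2 => if p.1 = p.2 then (1 : ℂ) else 0)
      (star fun p : Fin 2 × Fin 2 => if p.1 = p.2 then (1 : ℂ) else 0) (a, k) (b, l)) =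
      (Matrix.single k l 1 : Op1) := by
    intro k l
    ext a b
    fin_cases k <;> fin_cases l <;> fin_cases a <;> fin_cases b <;>
      simp [Matrix.vecMulVec_apply]
  have q : ∀ v : Fin 2 × Fin 2 → ℂ, 0 ≤ (∑ p, ∑ q, star (v p) *
      (N (Matrix.single p.2 q.2 1) p.1 q.1 * v q)).re := by
    intro v
    have h := (Complex.le_def.1 (hC.dotProduct_mulVec_nonneg v)).1
    simpa only [dotProduct, Matrix.mulVec, Pi.star_apply, ampliation_apply, hb, Finset.mul_sum,
      Complex.zero_re] using h
  have e := hD.1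
  have e0 := hD.2 0
  have e1 := hD.2 1
  have e2 := hD.2 2
  -- The test vectors are the four unnormalized Bell vectors; their expectations do not involve `t`.
  have qI := q fun p => if p.1 = p.2 then 1 else 0
  have qZ := q fun p => if p.1 = p.2 then (if p.1 = 0 then 1 else -1) else 0
  have qX := q fun p => if p.1 = p.2 then 0 else 1
  have qY := q fun p => if p.1 = p.2 then 0 else (if p.1 = 0 then 1 else -1)
  simp only [Fintype.sum_prod_type, Fin.sum_univ_two, single_zero_zero, single_one_one,
    single_zero_one, single_one_zero, map_smul, map_add, map_sub, e, e0, e1, e2] at qI qZ qX qY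
  simp [pauli, Fin.sum_univ_three] at qI qZ qX qY
  refine ⟨?_, ?_, ?_, ?_⟩ <;> linarith

/-- Conjugation by `P` fixes the `P`-component of a traceless `A` and negates the other two, so `A +
P A P†` is twice that component. -/
theorem normalForm_traceless {N : Op1 →ₗ[ℂ] Op1} {t D : Fin 3 → ℝ}
    (hD : ActsInNormalForm N t D) {A : Op1} (hA : A.trace = 0) :
    N A = ∑ P, ((D P / 2 : ℝ) : ℂ) • (A + pauli P * A * (pauli P)ᴴ) := by
  have h11 : A 1 1 = -A 0 0 := by
    rw [Matrix.trace_fin_two] at hA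
    linear_combination hA
  have hA' : A = ((A 0 1 + A 1 0) / 2) • pauli 0 + ((A 0 1 - A 1 0) / 2 * Complex.I) • pauli 1 +
      A 0 0 • pauli 2 := by
    ext a b
    fin_cases a <;> fin_cases b <;> simp [pauli, h11] <;> ring_nf <;> simp <;> ring
  have e0 : pauli 0 * A * (pauli 0)ᴴ = !![A 1 1, A 1 0; A 0 1, A 0 0] := by
    ext a b
    fin_cases a <;> fin_cases b <;>
      simp [pauli, Matrix.mul_apply, Matrix.conjTranspose_apply, Matrix.vecMul, dotProduct]
  have e1 : pauli 1 * A * (pauli 1)ᴴ = !![A 1 1, -A 1 0; -A 0 1, A 0 0] := by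
    ext a b
    fin_cases a <;> fin_cases b <;>
      simp [pauli, Matrix.mul_apply, Matrix.conjTranspose_apply, Matrix.vecMul, dotProduct] <;>
      ring_nf <;> simp
  have e2 : pauli 2 * A * (pauli 2)ᴴ = !![A 0 0, -A 0 1; -A 1 0, A 1 1] := by
    ext a b
    fin_cases a <;> fin_cases b <;>
      simp [pauli, Matrix.mul_apply, Matrix.conjTranspose_apply, Matrix.vecMul, dotProduct]
  rw [Fin.sum_univ_three, e0, e1, e2]
  conv_lhs => rw [hA']
  rw [map_add, map_add, map_smul, map_smul, map_smul, hD.2, hD.2, hD.2]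
  ext a b
  fin_cases a <;> fin_cases b <;> simp [pauli, h11] <;> ring_nf <;> simp <;> ring

theorem pauli_mem_unitaryGroup (P : Fin 3) : pauli P ∈ Matrix.unitaryGroup (Fin 2) ℂ := by
  rw [Matrix.mem_unitaryGroup_iff]
  fin_cases P <;> ext a b <;> fin_cases a <;> fin_cases b <;>
    simp [pauli, Matrix.mul_apply, Matrix.star_apply, Fin.sum_univ_two]

theorem conjTranspose_mem_unitaryGroup {U : Op1} (hU : U ∈ Matrix.unitaryGroup (Fin 2) ℂ) :
    Uᴴ ∈ Matrix.unitaryGroup (Fin 2) ℂ := Unitary.star_mem hU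

/-- Pairs of Choi inequalities give `D P ≤ 1`, hence `D P < 1`. Summing `|D P| ≤ M * (1 - D P)` and
using `-(D 0 + D 1 + D 2) ≤ 1` yields `4 * M`. -/
theorem sum_abs_le_noiseFactor {N : Op1 →ₗ[ℂ] Op1} {t D : Fin 3 → ℝ} (hN : HasNormalForm N t D)
    (hD : ∀ P, D P ≠ 1) : 0 ≤ noiseFactor D ∧ ∑ P, |D P| ≤ noiseFactor D / 3 := by
  obtain ⟨U, -, V, -, N', hN', hD', -⟩ := hN
  obtain ⟨h1, h2, h3, h4⟩ := normalForm_choi hN' hD'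
  have hlt : ∀ P, 0 < 1 - D P := by
    intro P
    have : D P ≤ 1 := by fin_cases P <;> simp <;> linarith
    have := lt_of_le_of_ne this (hD P)
    linarith
  set M := Finset.univ.sup' Finset.univ_nonempty (fun P => |D P| / (1 - D P)) with hM
  have hle : ∀ P, |D P| / (1 - D P) ≤ M := fun P =>
    Finset.le_sup' (fun P => |D P| / (1 - D P)) (Finset.mem_univ P)
  have hM0 : 0 ≤ M := (div_nonneg (abs_nonneg _) (hlt 0).le).trans (hle 0)
  have hle' : ∀ P, |D P| ≤ M * (1 - D P) := fun P => (div_le_iff₀ (hlt P)).1 (hle P)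
  have hnf : noiseFactor D = 12 * M := rfl
  refine ⟨by rw [hnf]; positivity, ?_⟩
  rw [hnf, Fin.sum_univ_three]
  nlinarith [hle' 0, hle' 1, hle' 2, mul_nonneg hM0 h1]

theorem traceNorm_noise_le {n : ℕ} {N : Op1 →ₗ[ℂ] Op1} {t D : Fin 3 → ℝ} (hc : IsChannel N)
    (hN : HasNormalForm N t D) (hD : ∀ P, D P ≠ 1) {i : Fin n} {X : Op n} (hX : X.IsHermitian)
    (h0 : depolAt i X = 0) :
    traceNorm (tensorMap (fun _ => N) X) ≤ noiseFactor D / 3 * traceNorm X := by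
  refine le_trans ?_ (mul_le_mul_of_nonneg_right (sum_abs_le_noiseFactor hN hD).2
    (traceNorm_nonneg X))
  obtain ⟨U, hU, V, hV, N', -, hD', hform⟩ := hN
  have hG : ∀ P, U * pauli P * Vᴴ ∈ Matrix.unitaryGroup (Fin 2) ℂ := fun P =>
    mul_mem (mul_mem hU (pauli_mem_unitaryGroup P)) (conjTranspose_mem_unitaryGroup hV)
  have hG0 : U * Vᴴ ∈ Matrix.unitaryGroup (Fin 2) ℂ :=
    mul_mem hU (conjTranspose_mem_unitaryGroup hV)
  have hVV : V * Vᴴ = 1 := (Matrix.mem_unitaryGroup_iff).1 hV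
  have hagree : ∀ A : Op1, A.trace = 0 → N A = (∑ P, ((D P / 2 : ℝ) : ℂ) •
      (conjMap (U * Vᴴ) + conjMap (U * pauli P * Vᴴ))) A := by
    intro A hA
    have hA' : (Vᴴ * A * V).trace = 0 := by
      rw [Matrix.trace_mul_comm, ← Matrix.mul_assoc, hVV, Matrix.one_mul, hA]
    rw [hform, normalForm_traceless hD' hA', LinearMap.sum_apply, Finset.mul_sum, Finset.sum_mul]
    refine Finset.sum_congr rfl fun P _ => ?_
    simp only [LinearMap.smul_apply, LinearMap.add_apply, conjMap_apply, Matrix.conjTranspose_mul,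
      Matrix.conjTranspose_conjTranspose, Matrix.mul_smul, Matrix.smul_mul, Matrix.mul_add,
      Matrix.add_mul, Matrix.mul_assoc]
  have hX1 : localApply N i X = ∑ P, ((D P / 2 : ℝ) : ℂ) •
      (tensorMap (update (fun _ => LinearMap.id) i (conjMap (U * Vᴴ))) X +
        tensorMap (update (fun _ => LinearMap.id) i (conjMap (U * pauli P * Vᴴ))) X) := by
    rw [localApply_congr hagree h0]
    ext x y
    simp only [localApply_apply, Matrix.sum_apply, Matrix.smul_apply, Matrix.add_apply,
      LinearMap.sum_apply, LinearMap.smul_apply, LinearMap.add_apply, tensorMap_update_id]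
  have hch : ∀ k, IsChannel (update (fun _ : Fin n => N) i LinearMap.id k) := by
    intro k
    by_cases hk : k = i
    · subst hk
      rw [update_self]
      exact ⟨fun _ => rfl, fun κ _ _ A hA => hA⟩
    · rw [update_of_ne hk]; exact hc
  have p0 := isPTP_local (isChannel_conjMap hG0) i
  have pP := fun P => isPTP_local (isChannel_conjMap (hG P)) i
  have hS : ∀ P, (tensorMap (update (fun _ => LinearMap.id) i (conjMap (U * Vᴴ))) X +
        tensorMap (update (fun _ => LinearMap.id) i (conjMap (U * pauli P * Vᴴ))) X).IsHermitian :=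
    fun P => (p0.isHermitian hX).add ((pP P).isHermitian hX)
  have hsum := traceNorm_sum_le Finset.univ
    (X := fun P => ((D P / 2 : ℝ) : ℂ) •
      (tensorMap (update (fun _ => LinearMap.id) i (conjMap (U * Vᴴ))) X +
        tensorMap (update (fun _ => LinearMap.id) i (conjMap (U * pauli P * Vᴴ))) X))
    fun P _ => isHermitian_real_smul (hS P) (D P / 2)
  -- Qubit `i` is rewritten as the combination of unitary conjugations; the remaining noise is a
  -- tensor product of channels and contracts.
  rw [tensorMap_eq_update_localApply (fun _ => N) i, hX1]
  refine ((isPTP_tensorMap hch).traceNorm_le hsum.1).trans (hsum.2.trans ?_)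
  rw [Finset.sum_mul]
  refine Finset.sum_le_sum fun P _ => (traceNorm_smul_le (hS P) _).trans ?_
  have h1 := traceNorm_add_le (p0.isHermitian hX) ((pP P).isHermitian hX)
  have h2 := p0.traceNorm_le hX
  have h3 := (pP P).traceNorm_le hX
  rw [abs_div, abs_two]
  calc |D P| / 2 * _ ≤ |D P| / 2 * (2 * traceNorm X) :=
        mul_le_mul_of_nonneg_left (by linarith) (by positivity)
    _ = _ := by ring

end Noise

/-! ### Decompositions underlying the W₁ norm and their cost under each layer. -/

section Wasserstein

variable {n : ℕ}

/-- `X` has a decomposition as in the definition of `w1Norm`, of total trace norm at most `r`. -/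
def HasW1Decomp (X : Op n) (r : ℝ) : Prop :=
  ∃ Y : Fin n → Op n, (∀ i, (Y i).IsHermitian ∧ depolAt i (Y i) = 0) ∧
    X = ∑ i, Y i ∧ ∑ i, traceNorm (Y i) ≤ r

theorem HasW1Decomp.mono {X : Op n} {r s : ℝ} (h : HasW1Decomp X r) (hrs : r ≤ s) :
    HasW1Decomp X s := by
  obtain ⟨Y, hY, e, hr⟩ := h
  exact ⟨Y, hY, e, hr.trans hrs⟩

theorem HasW1Decomp.zero : HasW1Decomp (0 : Op n) 0 :=
  ⟨fun _ => 0, fun _ => ⟨Matrix.isHermitian_zero, map_zero _⟩, by simp, by simp [traceNorm_zero]⟩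

theorem HasW1Decomp.add {X X' : Op n} {r r' : ℝ} (h : HasW1Decomp X r)
    (h' : HasW1Decomp X' r') : HasW1Decomp (X + X') (r + r') := by
  obtain ⟨Y, hY, e, hr⟩ := h
  obtain ⟨Y', hY', e', hr'⟩ := h'
  refine ⟨fun i => Y i + Y' i, fun i => ⟨(hY i).1.add (hY' i).1, ?_⟩, ?_, ?_⟩
  · rw [map_add, (hY i).2, (hY' i).2, add_zero]
  · rw [e, e', Finset.sum_add_distrib]
  · refine le_trans (Finset.sum_le_sum fun i _ => traceNorm_add_le (hY i).1 (hY' i).1) ?_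
    rw [Finset.sum_add_distrib]
    exact add_le_add hr hr'

theorem HasW1Decomp.sum {α : Type*} (s : Finset α) {X : α → Op n} {r : α → ℝ}
    (h : ∀ a ∈ s, HasW1Decomp (X a) (r a)) : HasW1Decomp (∑ a ∈ s, X a) (∑ a ∈ s, r a) := by
  classical
  induction s using Finset.induction_on with
  | empty => exact HasW1Decomp.zero
  | insert a s ha ih =>
    rw [Finset.sum_insert ha, Finset.sum_insert ha]
    exact (h a (Finset.mem_insert_self a s)).add
      (ih fun b hb => h b (Finset.mem_insert_of_mem hb))

theorem HasW1Decomp.of_depolAt {X : Op n} (hX : X.IsHermitian) {i : Fin n}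
    (h : depolAt i X = 0) : HasW1Decomp X (traceNorm X) := by
  refine ⟨fun k => if k = i then X else 0, fun k => ?_, by simp, ?_⟩
  · by_cases hk : k = i
    · subst hk; simp [hX, h]
    · simp [hk]
  · simp [apply_ite traceNorm, traceNorm_zero]

theorem HasW1Decomp.traceNorm_le {X : Op n} {r : ℝ} (h : HasW1Decomp X r) : traceNorm X ≤ r := by
  obtain ⟨Y, hY, e, hr⟩ := h
  rw [e]
  exact (traceNorm_sum_le Finset.univ fun i _ => (hY i).1).2.trans hr

theorem mem_w1_set_iff {X : Op n} {r : ℝ} :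
    (∃ Y : Fin n → Op n,
      (∀ i, (Y i).IsHermitian ∧ (Y i).trace = 0 ∧ partialTrace i (Y i) = 0) ∧
      X = ∑ i, Y i ∧ r = ∑ i, traceNorm (Y i)) ↔
    ∃ Y : Fin n → Op n, (∀ i, (Y i).IsHermitian ∧ depolAt i (Y i) = 0) ∧
      X = ∑ i, Y i ∧ r = ∑ i, traceNorm (Y i) := by
  refine exists_congr fun Y => and_congr_left fun _ => forall_congr' fun i => ?_
  rw [partialTrace_eq_zero_iff]
  refine and_congr_right fun _ => ⟨fun h => h.2, fun h => ⟨?_, h⟩⟩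
  rw [← (isPTP_depolAt i).1, h, Matrix.trace_zero]

/-- A map that scales the cost of every decomposition by `b` contracts `w1Norm` by `b`. -/
theorem w1Norm_le_mul {X X' : Op n} {b r₀ : ℝ} (hb : 0 ≤ b) (h₀ : HasW1Decomp X r₀)
    (h : ∀ r, HasW1Decomp X r → HasW1Decomp X' (b * r)) : w1Norm X' ≤ b * w1Norm X := by
  simp only [w1Norm, mem_w1_set_iff]
  set S := {r : ℝ | ∃ Y : Fin n → Op n, (∀ i, (Y i).IsHermitian ∧ depolAt i (Y i) = 0) ∧
      X = ∑ i, Y i ∧ r = ∑ i, traceNorm (Y i)}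
  set S' := {r : ℝ | ∃ Y : Fin n → Op n, (∀ i, (Y i).IsHermitian ∧ depolAt i (Y i) = 0) ∧
      X' = ∑ i, Y i ∧ r = ∑ i, traceNorm (Y i)}
  -- Needed because `sInf ∅ = 0` would make the right-hand side zero.
  have hS : S.Nonempty := by
    obtain ⟨Y, hY, e, -⟩ := h₀
    exact ⟨_, Y, hY, e, rfl⟩
  have hS' : BddBelow S' := by
    refine ⟨0, ?_⟩
    rintro r ⟨Y, -, -, rfl⟩
    exact Finset.sum_nonneg fun i _ => traceNorm_nonneg _
  have key : ∀ r ∈ S, sInf S' ≤ b * r := by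
    rintro r ⟨Y, hY, e, rfl⟩
    obtain ⟨Y', hY', e', hr'⟩ := h _ ⟨Y, hY, e, le_rfl⟩
    exact (csInf_le hS' ⟨Y', hY', e', rfl⟩).trans hr'
  have : sInf S' ≤ b * sInf S := by
    rcases hb.eq_or_lt with rfl | hb
    · obtain ⟨r, hr⟩ := hS
      simpa using key r hr
    · rw [← div_le_iff₀' hb]
      exact le_csInf hS fun r hr => (div_le_iff₀' hb).2 (key r hr)
  linarith

theorem HasW1Decomp.tensorMap {f : Fin n → Op1 →ₗ[ℂ] Op1} (hf : ∀ k, IsChannel (f k)) {X : Op n}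
    {r : ℝ} (h : HasW1Decomp X r) : HasW1Decomp (tensorMap f X) r := by
  obtain ⟨Y, hY, e, hr⟩ := h
  refine ⟨fun i => NoisyQC.tensorMap f (Y i), fun i => ⟨(isPTP_tensorMap hf).isHermitian (hY i).1,
    depolAt_tensorMap_eq_zero (hf i).1 (hY i).2⟩, by rw [e, map_sum], le_trans ?_ hr⟩
  exact Finset.sum_le_sum fun i _ => (isPTP_tensorMap hf).traceNorm_le (hY i).1

theorem HasW1Decomp.noise {N : Op1 →ₗ[ℂ] Op1} {t D : Fin 3 → ℝ} (hc : IsChannel N)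
    (hN : HasNormalForm N t D) (hD : ∀ P, D P ≠ 1) {X : Op n} {r : ℝ} (h : HasW1Decomp X r) :
    HasW1Decomp (NoisyQC.tensorMap (fun _ => N) X) (noiseFactor D / 3 * r) := by
  obtain ⟨Y, hY, e, hr⟩ := h
  have hb := (sum_abs_le_noiseFactor hN hD).1
  refine ⟨fun i => NoisyQC.tensorMap (fun _ => N) (Y i),
    fun i => ⟨(isPTP_tensorMap fun _ => hc).isHermitian (hY i).1,
      depolAt_tensorMap_eq_zero hc.1 (hY i).2⟩, by rw [e, map_sum], ?_⟩
  refine le_trans ?_ (mul_le_mul_of_nonneg_left hr (by positivity))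
  rw [Finset.mul_sum]
  exact Finset.sum_le_sum fun i _ => traceNorm_noise_le hc hN hD (hY i).1 (hY i).2

theorem IsTwoQubitLayer.isPTP {U : Op n} (hU : IsTwoQubitLayer U) : IsPTP (conjMap U) := by
  obtain ⟨gs, -, rfl⟩ := hU
  exact isPTP_conjMap_prod gs

theorem traceNorm_sub_depolAt_le {X : Op n} (hX : X.IsHermitian) (i : Fin n) :
    (X - depolAt i X).IsHermitian ∧ traceNorm (X - depolAt i X) ≤ 2 * traceNorm X := by
  have h := (isPTP_depolAt i).isHermitian hX
  refine ⟨hX.sub h, ?_⟩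
  rw [sub_eq_add_neg]
  have h1 := traceNorm_add_le hX h.neg
  have h2 := traceNorm_neg_le h
  have h3 := (isPTP_depolAt i).traceNorm_le hX
  linarith

/-- The constant is 2 for the part kept at site `i` plus 1 for the part moved to its partner `j`. -/
theorem HasW1Decomp.layer {U : Op n} (hU : IsTwoQubitLayer U) {X : Op n} {r : ℝ}
    (h : HasW1Decomp X r) : HasW1Decomp (conjMap U X) (3 * r) := by
  have hp := hU.isPTP
  obtain ⟨gs, hgs, rfl⟩ := hU
  obtain ⟨Y, hY, e, hr⟩ := h
  rw [e, map_sum]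
  refine HasW1Decomp.mono (HasW1Decomp.sum Finset.univ
    (r := fun i => 3 * traceNorm (Y i)) fun i _ => ?_) (by rw [← Finset.mul_sum]; linarith)
  obtain ⟨j, -, hj⟩ := exists_depolAt_depolAt_conjMap_prod hgs i
  set Z := conjMap (gs.map TwoQubitGate.op).prod (Y i)
  have hZ : Z.IsHermitian := hp.isHermitian (hY i).1
  have hZn : traceNorm Z ≤ traceNorm (Y i) := hp.traceNorm_le (hY i).1
  have h1 := traceNorm_sub_depolAt_le hZ i
  have h2 := (isPTP_depolAt i).isHermitian hZ
  have h3 := (isPTP_depolAt i).traceNorm_le hZ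
  have d1 : HasW1Decomp (Z - depolAt i Z) (traceNorm (Z - depolAt i Z)) :=
    HasW1Decomp.of_depolAt h1.1 (i := i) (by rw [map_sub, depolAt_comp_depolAt, sub_self])
  have d2 : HasW1Decomp (depolAt i Z) (traceNorm (depolAt i Z)) :=
    HasW1Decomp.of_depolAt h2 (hj _ (hY i).2)
  have := d1.add d2
  rw [sub_add_cancel] at this
  exact this.mono (by linarith [h1.2])

theorem tensorMap_depol_eq_zero {X : Op n} (hX : X.trace = 0) :
    tensorMap (fun _ => depol) X = 0 := by
  ext x y
  rw [tensorMap_apply]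
  have : ∀ x' y' : Fin n → Fin 2, ∏ k, depol (Matrix.single (x' k) (y' k) 1) (x k) (y k) =
      if x' = y' then ∏ k, (1 / 2 * (1 : Op1) (x k) (y k)) else 0 := by
    intro x' y'
    have hk : ∀ k, depol (Matrix.single (x' k) (y' k) 1) (x k) (y k) =
        if x' k = y' k then 1 / 2 * (1 : Op1) (x k) (y k) else 0 := by
      intro k
      rw [depol_apply, Matrix.smul_apply, smul_eq_mul]
      by_cases h : x' k = y' k
      · simp [h]
      · simp [h]
    simp only [hk, Finset.prod_ite_zero, funext_iff, Finset.mem_univ, true_implies]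
  simp only [this, mul_ite, mul_zero, Finset.sum_ite_eq, Finset.mem_univ, if_true]
  rw [← Finset.sum_mul]
  have h0 : ∑ x', X x' x' = 0 := hX
  rw [h0, zero_mul, Matrix.zero_apply]

/-- Telescoping over the qubits: a traceless operator has a decomposition. -/
theorem HasW1Decomp.of_trace_eq_zero {X : Op n} (hX : X.IsHermitian) (h0 : X.trace = 0) :
    HasW1Decomp X (2 * n * traceNorm X) := by
  -- Depolarizing one more qubit changes the operator by a term of that qubit's type, of norm at
  -- most `2 * traceNorm X`. Once all are depolarized, nothing is left of a traceless operator.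
  have key : ∀ S : Finset (Fin n), HasW1Decomp
      (X - NoisyQC.tensorMap (fun k => if k ∈ S then depol else LinearMap.id) X)
      (2 * S.card * traceNorm X) := by
    intro S
    induction S using Finset.induction_on with
    | empty => simpa [tensorMap_id] using HasW1Decomp.zero
    | insert a S ha ih =>
      have hch : ∀ k, IsChannel (if k ∈ S then depol else LinearMap.id) := by
        intro k
        by_cases hk : k ∈ S
        · rw [if_pos hk]; exact isChannel_depol
        · rw [if_neg hk]; exact ⟨fun _ => rfl, fun κ _ _ A hA => hA⟩
      have hp := isPTP_tensorMap hch
      set Z := NoisyQC.tensorMap (fun k => if k ∈ S then depol else LinearMap.id) X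
      have hZ : NoisyQC.tensorMap (fun k => if k ∈ insert a S then depol else LinearMap.id) X =
          depolAt a Z := by
        rw [depolAt, tensorMap_comp]
        congr 2
        funext k
        by_cases hk : k = a
        · subst hk; simp [ha]
        · simp [hk]
      have h1 := traceNorm_sub_depolAt_le (hp.isHermitian hX) a
      have d := HasW1Decomp.of_depolAt h1.1 (i := a)
        (by rw [map_sub, depolAt_comp_depolAt, sub_self])
      have h2 := ih.add d
      rw [sub_add_sub_cancel] at h2
      rw [hZ, Finset.card_insert_of_notMem ha]
      refine h2.mono ?_
      have h3 := hp.traceNorm_le hX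
      push_cast
      linarith [h1.2]
  have h := key Finset.univ
  simpa [tensorMap_depol_eq_zero h0] using h

end Wasserstein

/-! ### Iteration over the layers and the depth bound. -/

section Circuit

variable {n : ℕ}

theorem exists_noisyLayers_map {N : Op1 →ₗ[ℂ] Op1} {t D : Fin 3 → ℝ} (hc : IsChannel N)
    (hN : HasNormalForm N t D) (hD : ∀ P, D P ≠ 1) (L : ℕ) (U : Fin L → Op n)
    (hU : ∀ i, IsTwoQubitLayer (U i)) :
    ∃ F : Op n →ₗ[ℂ] Op n, IsPTP F ∧ (∀ A, noisyLayers N L U A = F A) ∧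
      (∀ X r, HasW1Decomp X r → HasW1Decomp (F X) (noiseFactor D ^ L * r)) ∧
      (0 < L → ∀ X : Op n, X.IsHermitian → X.trace = 0 →
        HasW1Decomp (F X) (n * noiseFactor D ^ L * traceNorm X)) := by
  have hb := (sum_abs_le_noiseFactor hN hD).1
  induction L with
  | zero =>
    exact ⟨LinearMap.id, IsPTP.id, fun A => rfl, fun X r h => by simpa using h,
      fun h => absurd h (lt_irrefl 0)⟩
  | succ L ih =>
    obtain ⟨F, hF, hFA, hF1, hF2⟩ := ih (fun i => U i.castSucc) fun i => hU _
    have hpU := (hU (Fin.last L)).isPTP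
    have step : ∀ X r, HasW1Decomp X r →
        HasW1Decomp (tensorMap (fun _ => N) (conjMap (U (Fin.last L)) X)) (noiseFactor D * r) :=
      fun X r h => ((h.layer (hU _)).noise hc hN hD).mono (le_of_eq (by ring))
    refine ⟨tensorMap (fun _ => N) ∘ₗ conjMap (U (Fin.last L)) ∘ₗ F,
      (isPTP_tensorMap fun _ => hc).comp (hpU.comp hF), fun A => ?_, fun X r h => ?_,
      fun _ X hX h0 => ?_⟩
    · rw [noisyLayers, hFA, tensorPow_eq_tensorMap]
      rfl
    · exact (step _ _ (hF1 X r h)).mono (le_of_eq (by ring))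
    -- In the first layer the decomposition is chosen after the unitaries, which preserve trace and
    -- do not increase trace norm; the factor is then `2 * n * (b / 3) ≤ n * b`.
    · rcases Nat.eq_zero_or_pos L with rfl | hL
      · have hX' : (conjMap (U (Fin.last 0)) (F X)).IsHermitian :=
          hpU.isHermitian (hF.isHermitian hX)
        have h0' : (conjMap (U (Fin.last 0)) (F X)).trace = 0 := by
          rw [hpU.1, hF.1, h0]
        refine ((HasW1Decomp.of_trace_eq_zero hX' h0').noise hc hN hD).mono ?_
        have h1 := (hpU.traceNorm_le (hF.isHermitian hX)).trans (hF.traceNorm_le hX)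
        calc noiseFactor D / 3 * (2 * n * traceNorm (conjMap (U (Fin.last 0)) (F X)))
            ≤ noiseFactor D / 3 * (2 * n * traceNorm X) := by gcongr
          _ ≤ noiseFactor D / 3 * (3 * n * traceNorm X) := by
              have := traceNorm_nonneg X
              gcongr
              norm_num
          _ = _ := by ring
      · exact (step _ _ (hF2 hL X hX h0)).mono (le_of_eq (by ring))

theorem exists_noisyCircuit_map {N : Op1 →ₗ[ℂ] Op1} {t D : Fin 3 → ℝ} (hc : IsChannel N)
    (hN : HasNormalForm N t D) (hD : ∀ P, D P ≠ 1) {L : ℕ} {U : Fin L → Op n} {V : Op n}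
    (hU : ∀ i, IsTwoQubitLayer (U i)) (hV : IsSingleQubitLayer V) :
    ∃ F : Op n →ₗ[ℂ] Op n, IsPTP F ∧ (∀ A, noisyCircuit N U V A = F A) ∧
      (∀ X r, HasW1Decomp X r → HasW1Decomp (F X) (noiseFactor D ^ L * r)) ∧
      (∀ X : Op n, X.IsHermitian → X.trace = 0 →
        traceNorm (F X) ≤ n * noiseFactor D ^ L * traceNorm X) := by
  obtain ⟨F, hF, hFA, hF1, hF2⟩ := exists_noisyLayers_map hc hN hD L U hU
  obtain ⟨u, hu, rfl⟩ := hV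
  have hch : ∀ k, IsChannel (conjMap (u k)) := fun k => isChannel_conjMap (hu k)
  have hp := (isPTP_tensorMap hch).comp hF
  refine ⟨tensorMap (fun k => conjMap (u k)) ∘ₗ F, hp, fun A => ?_,
    fun X r h => (hF1 X r h).tensorMap hch, fun X hX h0 => ?_⟩
  · rw [noisyCircuit, conjMap_tensorOp, hFA]
    rfl
  · rcases Nat.eq_zero_or_pos L with rfl | hL
    · refine (hp.traceNorm_le hX).trans ?_
      -- For `n = 0` the right-hand side vanishes, but so does a traceless operator on no qubits.
      rcases Nat.eq_zero_or_pos n with rfl | hn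
      · simpa using (HasW1Decomp.of_trace_eq_zero hX h0).traceNorm_le
      · rw [pow_zero, mul_one]
        exact le_mul_of_one_le_left (traceNorm_nonneg X) (by exact_mod_cast hn)
    · exact ((hF2 hL X hX h0).tensorMap hch).traceNorm_le

theorem IsState.sub {ρ σ : Op n} (hρ : IsState ρ) (hσ : IsState σ) :
    (ρ - σ).IsHermitian ∧ (ρ - σ).trace = 0 ∧ traceNorm (ρ - σ) ≤ 2 := by
  refine ⟨hρ.1.isHermitian.sub hσ.1.isHermitian, ?_, ?_⟩
  · rw [Matrix.trace_sub, hρ.2, hσ.2, sub_self]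
  · refine (traceNorm_sub_le hρ.1 hσ.1).trans (le_of_eq ?_)
    rw [hρ.2, hσ.2]
    norm_num

/-- The depth bound forces `b ^ L ≤ x⁻²`. -/
theorem pow_le_inv_sq_of_log_le {b x : ℝ} {L : ℕ} (hb0 : 0 < b) (hb1 : b < 1) (hx : 0 < x)
    (h : 2 * Real.log x / Real.log b⁻¹ ≤ L) : b ^ L ≤ (x ^ 2)⁻¹ := by
  have hlog : 0 < Real.log b⁻¹ := Real.log_pos ((one_lt_inv₀ hb0).2 hb1)
  rw [div_le_iff₀ hlog, Real.log_inv] at h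
  rw [← Real.log_le_log_iff (by positivity) (by positivity), Real.log_inv, Real.log_pow,
    Real.log_pow]
  push_cast
  linarith

end Circuit

end NoisyQC

theorem mainTheorem6 :
    (∀ (n L : ℕ) (N : Op1 →ₗ[ℂ] Op1) (t D : Fin 3 → ℝ),
      IsChannel N → HasNormalForm N t D → (∀ P, D P ≠ 1) →
      ∀ (U : Fin L → Op n) (V : Op n), (∀ i, IsTwoQubitLayer (U i)) → IsSingleQubitLayer V →
      ∀ ρ σ : Op n, IsState ρ → IsState σ →
        w1Norm (noisyCircuit N U V ρ - noisyCircuit N U V σ)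
            ≤ noiseFactor D ^ L * w1Norm (ρ - σ) ∧
        traceNorm (noisyCircuit N U V ρ - noisyCircuit N U V σ)
            ≤ (n : ℝ) * noiseFactor D ^ L * traceNorm (ρ - σ)) ∧
    (∃ C K : ℝ, 0 < C ∧ 0 < K ∧
      ∀ (n L : ℕ) (N : Op1 →ₗ[ℂ] Op1) (t D : Fin 3 → ℝ) (ε : ℝ),
      IsChannel N → HasNormalForm N t D → (∀ P, D P ≠ 1) →
      0 < ε → K ≤ (n : ℝ) ∨ K ≤ (n : ℝ) / ε →
      0 < noiseFactor D → noiseFactor D < 1 →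
      C * Real.log ((n : ℝ) / ε) / Real.log (noiseFactor D)⁻¹ ≤ (L : ℝ) →
      ∀ (U : Fin L → Op n) (V : Op n), (∀ i, IsTwoQubitLayer (U i)) → IsSingleQubitLayer V →
      ∀ ρ σ : Op n, IsState ρ → IsState σ →
        traceNorm (noisyCircuit N U V ρ - noisyCircuit N U V σ) ≤ ε) := by
  constructor
  · intro n L N t D hc hN hD U V hU hV ρ σ hρ hσ
    obtain ⟨F, -, hFA, hF1, hF2⟩ := exists_noisyCircuit_map hc hN hD hU hV
    obtain ⟨hX, h0, -⟩ := hρ.sub hσ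
    rw [hFA, hFA, ← map_sub]
    exact ⟨w1Norm_le_mul (pow_nonneg (sum_abs_le_noiseFactor hN hD).1 L)
      (HasW1Decomp.of_trace_eq_zero hX h0) (hF1 _), hF2 _ hX h0⟩
  -- `C = 2` gives `b ^ L ≤ (ε / n) ^ 2`, hence the bound `2 * ε ^ 2 / n`, which is at most `ε` when
  -- `n / ε ≥ 2`.
  · refine ⟨2, 4, by norm_num, by norm_num, ?_⟩
    intro n L N t D ε hc hN hD hε hK hb0 hb1 hL U V hU hV ρ σ hρ hσ
    obtain ⟨F, hF, hFA, -, hF2⟩ := exists_noisyCircuit_map hc hN hD hU hV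
    obtain ⟨hX, h0, h2⟩ := hρ.sub hσ
    rw [hFA, hFA, ← map_sub]
    have hXn := traceNorm_nonneg (ρ - σ)
    by_cases hnε : 2 ≤ (n : ℝ) / ε
    · have hn : 0 < (n : ℝ) := by
        by_contra hn
        have : (n : ℝ) / ε ≤ 0 := div_nonpos_of_nonpos_of_nonneg (not_lt.1 hn) hε.le
        linarith
      have hpow := pow_le_inv_sq_of_log_le hb0 hb1 (div_pos hn hε) hL
      have hεn : ε ≤ n / 2 := by
        rw [le_div_iff₀ hε] at hnε
        linarith
      calc traceNorm (F (ρ - σ)) ≤ n * noiseFactor D ^ L * traceNorm (ρ - σ) := hF2 _ hX h0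
        _ ≤ n * (((n : ℝ) / ε) ^ 2)⁻¹ * 2 := by gcongr
        _ = ε * (2 * ε / n) := by field_simp
        _ ≤ ε * 1 := by
            refine mul_le_mul_of_nonneg_left ?_ hε.le
            rw [div_le_one hn]
            linarith
        _ = ε := mul_one ε
    -- Here `n / ε < 2`, so `K = 4` forces `n ≥ 4` and `ε > 2`: the trivial bound 2 on the distance
    -- of states suffices.
    · have hn : 4 ≤ (n : ℝ) := hK.resolve_right fun h => hnε (by linarith)
      rw [le_div_iff₀ hε] at hnε
      exact ((hF.traceNorm_le hX).trans h2).trans (by linarith)
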